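/- Let $\Gamma$ be a finite undirected graph (loops and multiple edges allowed) with vertex set $V$, $|V|=k$, in which every edge consists of a pair of distinct mutually reverse arcs $a,a^-$; let $X$ be the set of arcs. Let $G$ be a finite group, $H\le G$ a subgroup of index $n$, and $\alpha:X\to G$ a voltage assignment, i.e. $\alpha(a^-)=\alpha(a)^{-1}$ for all $a\in X$. The relative lift $\Gamma^\alpha$ has vertex set $V\times G/H$ and arc set $X\times G/H$, where $G/H$ is the set of right cosets of $H$ in $G$; if $a$ is an arc from $u$ to $v$, then $(a,J)$ is an arc from $(u,J)$ to $(v,J\alpha(a))$, with reverse arc $(a^-,J\alpha(a))$. For a graph and real constants $c_1,\dots,c_4$, the universal adjacency matrix is $U=c_1A+c_2D+c_3I+c_4J$, where $A_{uv}$ is the number of arcs from $u$ to $v$, $D$ is the diagonal matrix of the degrees (the degree of $u$ is the number of arcs starting at $u$), $I$ is the identity matrix and $J$ is the all-1 matrix. Let $U^\alpha$ be this matrix for $\Gamma^\alpha$. For an element $s$ of the group algebra $\mathbb C[G]$, the universal base matrix is the $k\times k$ matrix over $\mathbb C[G]$ $$B_s(U)=c_1B(A)+c_2B(D)+c_3B(I)+c_4B_s(J),$$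 where $B(A)_{uv}$ is the sum of the elements $\alpha(a)$ over all arcs $a$ from $u$ to $v$, $B(D)$ is the diagonal matrix with entries $\deg(u)e$ ($e$ the identity of $G$), $B(I)$ is the diagonal matrix with entries $e$, and every entry of $B_s(J)$ is $s$. For a unitary matrix representation $\rho$ of $G$ of dimension $d_\rho$, extended linearly to $\mathbb C[G]$, let $\rho(B_s(U))$ be the $d_\rho k\times d_\rho k$ matrix obtained by replacing every entry by its image under $\rho$, and let $\rho(H)=\sum_{h\in H}\rho(h)$. Let $\mathrm{Irep}(G)$ be a complete set of representatives of the equivalence classes of irreducible unitary representations of $G$, and let $\mathrm{Sp}$ denote the multiset of all eigenvalues of a matrix, with algebraic multiplicity. Then $\mathrm{Irep}(G)$ is finite, $U^\alpha$ has $kn$ eigenvalues, and $$\mathrm{Sp}(U^\alpha)=\bigcup_{\rho\in\mathrm{Irep}(G)}\operatorname{rank}(\rho(H))\cdot\mathrm{Sp}\big(\rho(B_s(U))\big)$$ as a union of multisets with multiplicities added, where $r\cdot S$ means that every element of $S$ is taken $r$ times. This holds for $s=\pi^0+\pi^1+\cdots+\pi^{n-1}$, whenever $\pi\in G$ is an element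 which permutes the $n$ right cosets of $H$ by right multiplication in a single cycle of length $n$; and it holds for arbitrary $G$ and $H$, also if there is no such $\pi$, with $s=\frac1{|H|}\sum_{g\in G}g$. -/

import Mathlib

open scoped BigOperators

/-- An undirected graph with vertex set `V`, loops and multiple edges allowed. Every undirected
edge consists of a pair of distinct, mutually reverse arcs, and `X` is the set of arcs. -/
structure ArcGraph (V X : Type*) where
  tail : X → V
  head : X → V
  rev : X → X
  rev_rev : ∀ a, rev (rev a) = a
  rev_ne : ∀ a, rev a ≠ a
  tail_rev : ∀ a, tail (rev a) = head a

namespace ArcGraph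

variable {V X : Type*}

theorem head_rev (Γ : ArcGraph V X) (a : X) : Γ.head (Γ.rev a) = Γ.tail a := by
  rw [← Γ.tail_rev, Γ.rev_rev]

open scoped Classical in
/-- The adjacency matrix: the `(u, v)` entry is the number of arcs from `u` to `v`. -/
noncomputable def adjMatrix [Fintype X] (Γ : ArcGraph V X) : Matrix V V ℝ :=
  Matrix.of fun u v => ((Finset.univ.filter fun a => Γ.tail a = u ∧ Γ.head a = v).card : ℝ)

open scoped Classical in
/-- The degree of a vertex: the number of arcs that start there (so a loop counts twice). -/
noncomputable def degree [Fintype X] (Γ : ArcGraph V X) (u : V) : ℕ :=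
  (Finset.univ.filter fun a => Γ.tail a = u).card

/-- The universal adjacency matrix `U = c₁ A + c₂ D + c₃ I + c₄ J`. -/
noncomputable def universalMatrix [Fintype X] [DecidableEq V] (Γ : ArcGraph V X)
    (c₁ c₂ c₃ c₄ : ℝ) : Matrix V V ℝ :=
  c₁ • Γ.adjMatrix + c₂ • Matrix.diagonal (fun u => (Γ.degree u : ℝ)) +
    c₃ • (1 : Matrix V V ℝ) + c₄ • Matrix.of (fun _ _ => (1 : ℝ))

end ArcGraph

/-- A voltage assignment on `Γ` in the group `G`. -/
structure VoltageAssignment {V X : Type*} (Γ : ArcGraph V X) (G : Type*) [Group G] where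
  toFun : X → G
  map_rev : ∀ a, toFun (Γ.rev a) = (toFun a)⁻¹

/-- The set of right cosets `H x` of `H` in `G`. -/
def RightCosets {G : Type*} [Group G] (H : Subgroup G) : Type _ :=
  Quotient (QuotientGroup.rightRel H)

namespace RightCosets

variable {G : Type*} [Group G] {H : Subgroup G}

/-- The right coset `H x`. -/
def mk (H : Subgroup G) (x : G) : RightCosets H :=
  Quotient.mk (QuotientGroup.rightRel H) x

/-- Right multiplication of cosets: `(H x) g = H (x g)`. -/
def mul (J : RightCosets H) (g : G) : RightCosets H :=
  Quotient.map (sa := QuotientGroup.rightRel H) (sb := QuotientGroup.rightRel H)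
    (fun x : G => x * g)
    (fun x y h => by
      change QuotientGroup.rightRel H (x * g) (y * g)
      have h' : QuotientGroup.rightRel H x y := h
      rw [QuotientGroup.rightRel_apply] at h' ⊢
      simpa [mul_assoc] using h') J

theorem mk_mul (x g : G) : (mk H x).mul g = mk H (x * g) := rfl

theorem mul_mul (J : RightCosets H) (g g' : G) : (J.mul g).mul g' = J.mul (g * g') := by
  induction J using Quotient.inductionOn with
  | h x => exact congrArg (mk H) (mul_assoc x g g')

theorem mul_one (J : RightCosets H) : J.mul 1 = J := by
  induction J using Quotient.inductionOn with
  | h x => exact congrArg (mk H) (_root_.mul_one x)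

/-- The permutation of the right cosets given by right multiplication by `g`. -/
def mulPerm (H : Subgroup G) (g : G) : Equiv.Perm (RightCosets H) where
  toFun J := J.mul g
  invFun J := J.mul g⁻¹
  left_inv J := by
    change (J.mul g).mul g⁻¹ = J
    rw [mul_mul, mul_inv_cancel, mul_one]
  right_inv J := by
    change (J.mul g⁻¹).mul g = J
    rw [mul_mul, inv_mul_cancel, mul_one]

instance [Finite G] : Finite (RightCosets H) :=
  inferInstanceAs (Finite (Quotient (QuotientGroup.rightRel H)))

noncomputable instance [Finite G] : Fintype (RightCosets H) := Fintype.ofFinite _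

noncomputable instance : DecidableEq (RightCosets H) := Classical.decEq _

end RightCosets

/-- The relative lift of `Γ`: for every arc `a` from `u` to `v` and every right coset `J` there is
an arc `(a, J)` from `(u, J)` to `(v, J α(a))`; its reverse is `(a⁻, J α(a))`. -/
def ArcGraph.relativeLift {V X : Type*} (Γ : ArcGraph V X) {G : Type*} [Group G]
    (α : VoltageAssignment Γ G) (H : Subgroup G) :
    ArcGraph (V × RightCosets H) (X × RightCosets H) where
  tail p := (Γ.tail p.1, p.2)
  head p := (Γ.head p.1, p.2.mul (α.toFun p.1))
  rev p := (Γ.rev p.1, p.2.mul (α.toFun p.1))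
  rev_rev p := by
    simp only [Γ.rev_rev, α.map_rev, RightCosets.mul_mul, mul_inv_cancel, RightCosets.mul_one]
  rev_ne p h := Γ.rev_ne p.1 (congrArg Prod.fst h)
  tail_rev p := by simp only [Γ.tail_rev]

section BaseMatrix

variable {V X : Type*} {G : Type*} [Group G]

/-- The sum `π⁰ + π¹ + ⋯ + πⁿ⁻¹` in the group algebra. -/
noncomputable def powerSum (π : G) (n : ℕ) : MonoidAlgebra ℂ G :=
  ∑ i ∈ Finset.range n, MonoidAlgebra.of ℂ G (π ^ i)

open scoped Classical in
/-- The sum of the elements of the subgroup `H` in the group algebra. -/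
noncomputable def subgroupSum [Fintype G] (H : Subgroup G) : MonoidAlgebra ℂ G :=
  ∑ h ∈ Finset.univ.filter (fun g => g ∈ H), MonoidAlgebra.of ℂ G h

/-- The element `|H|⁻¹ ∑_{g ∈ G} g` of the group algebra. -/
noncomputable def averageSum [Fintype G] (H : Subgroup G) : MonoidAlgebra ℂ G :=
  ((Nat.card H : ℂ)⁻¹) • ∑ g : G, MonoidAlgebra.of ℂ G g

open scoped Classical in
/-- The base matrix `B(A)`: the `(u, v)` entry is the sum of the voltages on the arcs from
`u` to `v`. -/
noncomputable def baseAdj [Fintype X] (Γ : ArcGraph V X) (α : VoltageAssignment Γ G) :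
    Matrix V V (MonoidAlgebra ℂ G) :=
  Matrix.of fun u v =>
    ∑ a ∈ Finset.univ.filter (fun a => Γ.tail a = u ∧ Γ.head a = v),
      MonoidAlgebra.of ℂ G (α.toFun a)

/-- The universal base matrix `B(U) = c₁ B(A) + c₂ B(D) + c₃ B(I) + c₄ B(J)`, where every entry
of `B(J)` is the element `s` of the group algebra. -/
noncomputable def universalBaseMatrix [Fintype X] [DecidableEq V] (Γ : ArcGraph V X)
    (α : VoltageAssignment Γ G) (s : MonoidAlgebra ℂ G) (c₁ c₂ c₃ c₄ : ℝ) :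
    Matrix V V (MonoidAlgebra ℂ G) :=
  (c₁ : ℂ) • baseAdj Γ α +
    (c₂ : ℂ) • Matrix.diagonal (fun u => (Γ.degree u : ℂ) • (1 : MonoidAlgebra ℂ G)) +
    (c₃ : ℂ) • (1 : Matrix V V (MonoidAlgebra ℂ G)) + (c₄ : ℂ) • Matrix.of (fun _ _ => s)

end BaseMatrix

/-- The homomorphism into matrices underlying a homomorphism into the unitary group. -/
def unitaryMatrixHom {G : Type*} [Group G] {d : ℕ} (ρ : G →* Matrix.unitaryGroup (Fin d) ℂ) :
    G →* Matrix (Fin d) (Fin d) ℂ :=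
  (Matrix.unitaryGroup (Fin d) ℂ).subtype.comp ρ

/-- The action on column vectors of a group of unitary matrices. -/
noncomputable def unitaryRepresentation {G : Type*} [Group G] {d : ℕ}
    (ρ : G →* Matrix.unitaryGroup (Fin d) ℂ) : Representation ℂ G (Fin d → ℂ) :=
  (Matrix.toLinAlgEquiv' (R := ℂ) (n := Fin d) :
    Matrix (Fin d) (Fin d) ℂ →* ((Fin d → ℂ) →ₗ[ℂ] (Fin d → ℂ))).comp (unitaryMatrixHom ρ)

/-- An irreducible unitary (matrix) representation of `G`. -/
structure UnitaryIrrep (G : Type*) [Group G] where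
  dim : ℕ
  hom : G →* Matrix.unitaryGroup (Fin dim) ℂ
  irreducible : (unitaryRepresentation hom).IsIrreducible

namespace UnitaryIrrep

variable {G : Type*} [Group G]

/-- Equivalence of representations. -/
def Equivalent (ρ σ : UnitaryIrrep G) : Prop :=
  Nonempty (Representation.Equiv (unitaryRepresentation ρ.hom) (unitaryRepresentation σ.hom))

/-- The linear extension of `ρ` to the group algebra. -/
noncomputable def toAlgHom (ρ : UnitaryIrrep G) :
    MonoidAlgebra ℂ G →ₐ[ℂ] Matrix (Fin ρ.dim) (Fin ρ.dim) ℂ :=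
  MonoidAlgebra.lift ℂ (Matrix (Fin ρ.dim) (Fin ρ.dim) ℂ) G (unitaryMatrixHom ρ.hom)

/-- The `ρ`-image of a matrix over the group algebra, a block matrix with blocks `ρ(B_{uv})`. -/
noncomputable def image {V : Type*} (ρ : UnitaryIrrep G) (B : Matrix V V (MonoidAlgebra ℂ G)) :
    Matrix (V × Fin ρ.dim) (V × Fin ρ.dim) ℂ :=
  Matrix.of fun p q => ρ.toAlgHom (B p.1 q.1) p.2 q.2

/-- A family containing exactly one representative of each equivalence class of irreducible
unitary representations of `G`. -/
def IsCompleteSystem {ι : Type*} (ρ : ι → UnitaryIrrep G) : Prop :=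
  ∀ σ : UnitaryIrrep G, ∃! i, σ.Equivalent (ρ i)

end UnitaryIrrep

/-- The multiset of the eigenvalues of a complex matrix, repeated according to their algebraic
multiplicity. -/
noncomputable def matrixSpectrum {m : Type*} [Fintype m] [DecidableEq m] (M : Matrix m m ℂ) :
    Multiset ℂ :=
  M.charpoly.roots

/-!
Let `P` be the permutation representation of `G` on the right cosets of `H`. An entry of the
adjacency matrix of the relative lift counts the arcs `a` from `u` to `v` with `J α(a) = K`, so it
is an entry of `P(B(A)_{uv})`; degrees are unchanged by lifting, and for both choices of `s` the
matrix `P(s)` has all entries `1`. Hence the universal matrix of the lift is the block matrix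
`P(B_s(U))` (`universalMatrix_relativeLift`).

The matrices of `P` are unitary. The orthogonal complement of an invariant subspace being invariant,
`P` is similar to a direct sum of irreducible unitary representations, and the characteristic
polynomial of `P(B)` is the product of the powers `charpoly(ρ(B)) ^ m(ρ)`, where `m(ρ)` is the
multiplicity of `ρ` in `P` (`exists_multiplicities`).

By orthogonality of characters `m(ρ)` is the inner product of the characters of `P` and `ρ`. The
stabilizer of `H x` is `x⁻¹ H x`, so this inner product is the mean of the character of `ρ` over `H`
(`sum_trace_cosetMatrixHom_mul`). That mean is the trace of the idempotent `|H|⁻¹ ρ(H)`, which is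
`rank ρ(H)` (`rank_subgroupSum`).
-/

/-! ### Images of matrices over the group algebra -/

section BlockImage

open scoped Kronecker

variable {G : Type*} [Group G] {V m m' m₁ m₂ : Type*}

/-- The image of a matrix over `ℂ[G]` under a matrix representation `τ` of `G`: the block matrix
whose `(u, v)` block is `τ` (extended linearly) applied to the `(u, v)` entry. -/
noncomputable def blockImage [Fintype m] [DecidableEq m] (τ : G →* Matrix m m ℂ)
    (B : Matrix V V (MonoidAlgebra ℂ G)) : Matrix (V × m) (V × m) ℂ :=
  Matrix.of fun p q => MonoidAlgebra.lift ℂ (Matrix m m ℂ) G τ (B p.1 q.1) p.2 q.2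

variable [Fintype m] [DecidableEq m] [Fintype m'] [DecidableEq m']
  [Fintype m₁] [DecidableEq m₁] [Fintype m₂] [DecidableEq m₂]

/-- A matrix that intertwines two representations of `G` intertwines their extensions to `ℂ[G]`. -/
theorem lift_mul_eq_mul_lift {τ : G →* Matrix m m ℂ} {τ' : G →* Matrix m' m' ℂ}
    {Q : Matrix m m' ℂ} (h : ∀ g, τ g * Q = Q * τ' g) (x : MonoidAlgebra ℂ G) :
    MonoidAlgebra.lift ℂ (Matrix m m ℂ) G τ x * Q =
      Q * MonoidAlgebra.lift ℂ (Matrix m' m' ℂ) G τ' x := by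
  induction x using MonoidAlgebra.induction_on with
  | of g => simpa using h g
  | add x y hx hy => rw [map_add, map_add, Matrix.add_mul, Matrix.mul_add, hx, hy]
  | smul r x hx => rw [map_smul, map_smul, Matrix.smul_mul, Matrix.mul_smul, hx]

/-- Similar matrices have the same characteristic polynomial, in a form that allows different index
types. -/
theorem charpoly_eq_of_mul_eq_mul {l l' : Type*} [Fintype l] [DecidableEq l] [Fintype l']
    [DecidableEq l'] {M : Matrix l l ℂ} {M' : Matrix l' l' ℂ} {Q : Matrix l l' ℂ}
    {Q' : Matrix l' l ℂ} (h₁ : Q' * Q = 1) (h₂ : Q * Q' = 1) (h : M * Q = Q * M') :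
    M.charpoly = M'.charpoly := by
  have hc : Fintype.card l = Fintype.card l' := by
    have e := Matrix.trace_mul_comm Q Q'
    rw [h₁, h₂, Matrix.trace_one, Matrix.trace_one] at e
    exact_mod_cast e
  have hM : M = Q * (M' * Q') := by rw [← Matrix.mul_assoc, ← h, Matrix.mul_assoc, h₂, mul_one]
  have hM' : M' = (M' * Q') * Q := by rw [Matrix.mul_assoc, h₁, mul_one]
  have e := Matrix.charpoly_mul_comm' Q (M' * Q')
  rw [← hM, ← hM', hc] at e
  exact (Polynomial.isRegular_X_pow _).left.eq_iff.mp e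

theorem trace_eq_of_mul_eq_mul {l l' : Type*} [Fintype l] [DecidableEq l] [Fintype l']
    [DecidableEq l'] {M : Matrix l l ℂ} {M' : Matrix l' l' ℂ} {Q : Matrix l l' ℂ}
    {Q' : Matrix l' l ℂ} (h₁ : Q' * Q = 1) (h₂ : Q * Q' = 1) (h : M * Q = Q * M') :
    M.trace = M'.trace := by
  have hM : M = Q * (M' * Q') := by rw [← Matrix.mul_assoc, ← h, Matrix.mul_assoc, h₂, mul_one]
  rw [hM, Matrix.trace_mul_comm, Matrix.mul_assoc, h₁, mul_one]

theorem charpoly_blockImage_congr [Fintype V] [DecidableEq V] {τ : G →* Matrix m m ℂ}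
    {τ' : G →* Matrix m' m' ℂ} {Q : Matrix m m' ℂ} {Q' : Matrix m' m ℂ} (h₁ : Q' * Q = 1)
    (h₂ : Q * Q' = 1) (h : ∀ g, τ g * Q = Q * τ' g) (B : Matrix V V (MonoidAlgebra ℂ G)) :
    (blockImage τ B).charpoly = (blockImage τ' B).charpoly := by
  -- The block images are intertwined by the block diagonal matrix with all blocks `Q`.
  refine charpoly_eq_of_mul_eq_mul (Q := (1 : Matrix V V ℂ) ⊗ₖ Q) (Q' := (1 : Matrix V V ℂ) ⊗ₖ Q')
    ?_ ?_ ?_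
  · rw [← Matrix.mul_kronecker_mul, h₁, one_mul, Matrix.one_kronecker_one]
  · rw [← Matrix.mul_kronecker_mul, h₂, one_mul, Matrix.one_kronecker_one]
  · ext ⟨u, i⟩ ⟨v, j⟩
    have := congrFun (congrFun (lift_mul_eq_mul_lift h (B u v)) i) j
    simpa [Matrix.mul_apply, Fintype.sum_prod_type, blockImage, Matrix.one_apply] using this

theorem charpoly_blockImage_fromBlocks [Fintype V] [DecidableEq V]
    {τ : G →* Matrix (m₁ ⊕ m₂) (m₁ ⊕ m₂) ℂ} {τ₁ : G →* Matrix m₁ m₁ ℂ} {τ₂ : G →* Matrix m₂ m₂ ℂ}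
    (h : ∀ g, τ g = Matrix.fromBlocks (τ₁ g) 0 0 (τ₂ g)) (B : Matrix V V (MonoidAlgebra ℂ G)) :
    (blockImage τ B).charpoly = (blockImage τ₁ B).charpoly * (blockImage τ₂ B).charpoly := by
  have hl : ∀ x : MonoidAlgebra ℂ G, MonoidAlgebra.lift ℂ _ G τ x =
      Matrix.fromBlocks (MonoidAlgebra.lift ℂ _ G τ₁ x) 0 0 (MonoidAlgebra.lift ℂ _ G τ₂ x) := by
    intro x
    induction x using MonoidAlgebra.induction_on with
    | of g => simpa using h g
    | add x y hx hy => simp [map_add, hx, hy, Matrix.fromBlocks_add]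
    | smul r x hx => simp [map_smul, hx, Matrix.fromBlocks_smul]
  rw [← Matrix.charpoly_reindex (Equiv.prodSumDistrib V m₁ m₂),
    ← Matrix.charpoly_fromBlocks_zero₁₂ (M₂₁ := 0)]
  congr 1
  ext (⟨u, i⟩ | ⟨u, i⟩) (⟨v, j⟩ | ⟨v, j⟩) <;> simp [blockImage, hl]

end BlockImage

/-! ### Complete reducibility of unitary representations -/

section Decomposition

open Matrix

variable {G : Type*} [Group G]

theorem coe_inv_unitaryGroup {m : Type*} [Fintype m] [DecidableEq m]
    (σ : G →* Matrix.unitaryGroup m ℂ) (g : G) :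
    (σ g⁻¹ : Matrix m m ℂ) = (σ g : Matrix m m ℂ)ᴴ := by
  rw [map_inv]; rfl

/-- If `P` has orthonormal columns spanning an invariant subspace and the columns of `R` span its
orthogonal complement, the compression `Pᴴ σ(g) P` is again a unitary representation. The relation
`h` says that the column space of `P` is invariant. -/
theorem exists_compression {m m₁ m₂ : Type*} [Fintype m] [DecidableEq m] [Fintype m₁]
    [DecidableEq m₁] [Fintype m₂] (σ : G →* Matrix.unitaryGroup m ℂ)
    {P : Matrix m m₁ ℂ} {R : Matrix m m₂ ℂ} (hP : Pᴴ * P = 1) (hPR : P * Pᴴ + R * Rᴴ = 1)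
    (h : ∀ g, Rᴴ * (σ g : Matrix m m ℂ) * P = 0) :
    ∃ σ₁ : G →* Matrix.unitaryGroup m₁ ℂ,
      ∀ g, (σ₁ g : Matrix m₁ m₁ ℂ) = Pᴴ * (σ g : Matrix m m ℂ) * P := by
  have hmul : ∀ a b, Pᴴ * (σ (a * b) : Matrix m m ℂ) * P =
      Pᴴ * (σ a : Matrix m m ℂ) * P * (Pᴴ * (σ b : Matrix m m ℂ) * P) := by
    intro a b
    calc Pᴴ * (σ (a * b) : Matrix m m ℂ) * P
        = Pᴴ * (σ a : Matrix m m ℂ) * (P * Pᴴ + R * Rᴴ) * (σ b : Matrix m m ℂ) * P := by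
          rw [hPR, map_mul]; simp [Matrix.mul_assoc]
      _ = Pᴴ * (σ a : Matrix m m ℂ) * P * (Pᴴ * (σ b : Matrix m m ℂ) * P) +
          Pᴴ * (σ a : Matrix m m ℂ) * R * (Rᴴ * (σ b : Matrix m m ℂ) * P) := by
          simp only [Matrix.mul_add, Matrix.add_mul, Matrix.mul_assoc]
      _ = _ := by rw [h, Matrix.mul_zero, add_zero]
  have hone : Pᴴ * (σ 1 : Matrix m m ℂ) * P = 1 := by simp [hP]
  have hstar : ∀ g, star (Pᴴ * (σ g : Matrix m m ℂ) * P) =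
      Pᴴ * (σ g⁻¹ : Matrix m m ℂ) * P := by
    intro g
    rw [coe_inv_unitaryGroup, star_eq_conjTranspose]
    simp [Matrix.conjTranspose_mul, Matrix.mul_assoc]
  refine ⟨⟨⟨fun g => ⟨Pᴴ * (σ g : Matrix m m ℂ) * P, ?_⟩, ?_⟩, ?_⟩, fun g => rfl⟩
  · rw [Matrix.mem_unitaryGroup_iff, hstar, ← hmul, mul_inv_cancel, hone]
  · exact Subtype.ext hone
  · exact fun a b => Subtype.ext (hmul a b)

/-- A unitary representation with a proper nonzero invariant subspace `p` is similar to the direct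
sum of two unitary representations of smaller dimension, those on `p` and on `pᗮ`. -/
theorem exists_blockDiagonal_of_invariant {d : ℕ} (σ : G →* Matrix.unitaryGroup (Fin d) ℂ)
    (p : Submodule ℂ (EuclideanSpace ℂ (Fin d))) (hp : p ≠ ⊥) (hp' : p ≠ ⊤)
    (hinv : ∀ g, ∀ x ∈ p, Matrix.toEuclideanLin (σ g : Matrix (Fin d) (Fin d) ℂ) x ∈ p) :
    ∃ (d₁ d₂ : ℕ) (_ : d₁ < d) (_ : d₂ < d) (σ₁ : G →* Matrix.unitaryGroup (Fin d₁) ℂ)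
      (σ₂ : G →* Matrix.unitaryGroup (Fin d₂) ℂ) (Q : Matrix (Fin d) (Fin d₁ ⊕ Fin d₂) ℂ)
      (Q' : Matrix (Fin d₁ ⊕ Fin d₂) (Fin d) ℂ), Q' * Q = 1 ∧ Q * Q' = 1 ∧
      ∀ g, (σ g : Matrix (Fin d) (Fin d) ℂ) * Q =
        Q * (Matrix.fromBlocks (σ₁ g : Matrix (Fin d₁) (Fin d₁) ℂ) 0 0
          (σ₂ g : Matrix (Fin d₂) (Fin d₂) ℂ) : Matrix (Fin d₁ ⊕ Fin d₂) (Fin d₁ ⊕ Fin d₂) ℂ) := by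
  let d₁ := Module.finrank ℂ p
  let d₂ := Module.finrank ℂ pᗮ
  let b₁ : OrthonormalBasis (Fin d₁) ℂ p := stdOrthonormalBasis ℂ p
  let b₂ : OrthonormalBasis (Fin d₂) ℂ pᗮ := stdOrthonormalBasis ℂ pᗮ
  have hd : d₁ + d₂ = d := by
    rw [Submodule.finrank_add_finrank_orthogonal, finrank_euclideanSpace_fin]
  have hd₁ : 0 < d₁ := Module.finrank_pos_iff.2 (Submodule.nontrivial_iff_ne_bot.2 hp)
  have hd₂ : 0 < d₂ := Module.finrank_pos_iff.2 (Submodule.nontrivial_iff_ne_bot.2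
    (by rwa [Ne, Submodule.orthogonal_eq_bot_iff]))
  let P : Matrix (Fin d) (Fin d₁) ℂ := Matrix.of fun i j => (b₁ j : EuclideanSpace ℂ (Fin d)) i
  let R : Matrix (Fin d) (Fin d₂) ℂ := Matrix.of fun i j => (b₂ j : EuclideanSpace ℂ (Fin d)) i
  have key : ∀ {k l : ℕ} (x : Fin k → EuclideanSpace ℂ (Fin d))
      (y : Fin l → EuclideanSpace ℂ (Fin d)) (i j),
      ((Matrix.of fun i j => x j i : Matrix (Fin d) (Fin k) ℂ)ᴴ *
        (Matrix.of fun i j => y j i : Matrix (Fin d) (Fin l) ℂ)) i j = inner ℂ (x i) (y j) := by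
    intro k l x y i j
    simp [Matrix.mul_apply, PiLp.inner_apply, mul_comm]
  have hP : Pᴴ * P = 1 := by
    ext i j
    rw [key]
    simpa [Matrix.one_apply] using (orthonormal_iff_ite.1 b₁.orthonormal) i j
  have hR : Rᴴ * R = 1 := by
    ext i j
    rw [key]
    simpa [Matrix.one_apply] using (orthonormal_iff_ite.1 b₂.orthonormal) i j
  have hPR : Pᴴ * R = 0 := by
    ext i j
    rw [key]
    exact Submodule.inner_right_of_mem_orthogonal (b₁ i).2 (b₂ j).2
  have hRP : Rᴴ * P = 0 := by
    ext i j
    rw [key]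
    exact Submodule.inner_left_of_mem_orthogonal (b₁ j).2 (b₂ i).2
  have hQ : (fromRows Pᴴ Rᴴ) * (fromCols P R) = 1 := by
    rw [fromRows_mul_fromCols, hP, hR, hPR, hRP, fromBlocks_one]
  have hQ' : (fromCols P R) * (fromRows Pᴴ Rᴴ) = 1 :=
    (mul_eq_one_comm_of_card_eq _ _ _ (by simp [hd])).1 hQ
  have hsum : P * Pᴴ + R * Rᴴ = 1 := by rwa [fromCols_mul_fromRows] at hQ'
  have h₁ : ∀ g, Rᴴ * (σ g : Matrix (Fin d) (Fin d) ℂ) * P = 0 := by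
    intro g
    have hσ : (σ g : Matrix (Fin d) (Fin d) ℂ) * P =
        Matrix.of fun i j => (Matrix.toEuclideanLin (σ g : Matrix (Fin d) (Fin d) ℂ) (b₁ j)) i := by
      ext i j
      simp [P, Matrix.mul_apply, Matrix.mulVec, dotProduct]
    ext i j
    rw [Matrix.mul_assoc, hσ, key]
    exact Submodule.inner_left_of_mem_orthogonal (hinv g _ (b₁ j).2) (b₂ i).2
  -- Unitarity makes the orthogonal complement invariant too: take adjoints at `g⁻¹`.
  have h₂ : ∀ g, Pᴴ * (σ g : Matrix (Fin d) (Fin d) ℂ) * R = 0 := by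
    intro g
    have := congrArg conjTranspose (h₁ g⁻¹)
    rw [coe_inv_unitaryGroup] at this
    simpa [Matrix.mul_assoc] using this
  obtain ⟨σ₁, hσ₁⟩ := exists_compression σ hP hsum h₁
  obtain ⟨σ₂, hσ₂⟩ := exists_compression σ hR (by rwa [add_comm]) h₂
  refine ⟨d₁, d₂, by omega, by omega, σ₁, σ₂, fromCols P R, fromRows Pᴴ Rᴴ, hQ, hQ', fun g => ?_⟩
  have hb : Matrix.fromBlocks (σ₁ g : Matrix (Fin d₁) (Fin d₁) ℂ) 0 0
      (σ₂ g : Matrix (Fin d₂) (Fin d₂) ℂ) =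
      fromRows Pᴴ Rᴴ * ((σ g : Matrix (Fin d) (Fin d) ℂ) * fromCols P R) := by
    rw [mul_fromCols, fromRows_mul_fromCols, hσ₁, hσ₂, ← Matrix.mul_assoc, ← Matrix.mul_assoc,
      ← Matrix.mul_assoc, ← Matrix.mul_assoc, h₁, h₂]
  rw [hb, ← Matrix.mul_assoc, hQ', Matrix.one_mul]

variable {ι : Type*} [Fintype ι]

/-- Complete reducibility, in the form needed for spectra: there are multiplicities `n i` by which
both the characteristic polynomials of the block images and the character of `σ` decompose. -/
theorem exists_multiplicities {ρ : ι → UnitaryIrrep G} (hρ : UnitaryIrrep.IsCompleteSystem ρ)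
    {V : Type*} [Fintype V] [DecidableEq V] {d : ℕ} (σ : G →* Matrix.unitaryGroup (Fin d) ℂ) :
    ∃ n : ι → ℕ,
      (∀ B : Matrix V V (MonoidAlgebra ℂ G), (blockImage (unitaryMatrixHom σ) B).charpoly =
        ∏ i, ((ρ i).image B).charpoly ^ n i) ∧
      ∀ g, (unitaryMatrixHom σ g).trace =
        ∑ i, n i * (unitaryMatrixHom (ρ i).hom g).trace := by
  classical
  induction d using Nat.strong_induction_on with
  | _ d ih =>
  rcases Nat.eq_zero_or_pos d with rfl | hd
  · exact ⟨0, fun B => by simp [Matrix.charpoly], fun g => by simp [Matrix.trace]⟩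
  by_cases hirr : (unitaryRepresentation σ).IsIrreducible
  · obtain ⟨i, ⟨φ⟩, -⟩ := hρ ⟨d, σ, hirr⟩
    let Q : Matrix (Fin (ρ i).dim) (Fin d) ℂ := LinearMap.toMatrix' φ.toLinearEquiv.toLinearMap
    let Q' : Matrix (Fin d) (Fin (ρ i).dim) ℂ :=
      LinearMap.toMatrix' φ.toLinearEquiv.symm.toLinearMap
    have e₁ := φ.toLinearEquiv.symm_comp
    have e₂ := φ.toLinearEquiv.comp_symm
    have h₁ : Q' * Q = 1 := by
      rw [← LinearMap.toMatrix'_comp, e₁, LinearMap.toMatrix'_id]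
    have h₂ : Q * Q' = 1 := by
      rw [← LinearMap.toMatrix'_comp, e₂, LinearMap.toMatrix'_id]
    have h : ∀ g, unitaryMatrixHom (ρ i).hom g * Q = Q * unitaryMatrixHom σ g := by
      intro g
      have h' : (Matrix.toLin' (unitaryMatrixHom (ρ i).hom g)) ∘ₗ φ.toLinearEquiv.toLinearMap =
          φ.toLinearEquiv.toLinearMap ∘ₗ (Matrix.toLin' (unitaryMatrixHom σ g)) :=
        (φ.isIntertwining' g).symm
      have := congrArg LinearMap.toMatrix' h'
      rwa [LinearMap.toMatrix'_comp, LinearMap.toMatrix'_comp, LinearMap.toMatrix'_toLin',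
        LinearMap.toMatrix'_toLin'] at this
    refine ⟨Pi.single i 1, fun B => ?_, fun g => ?_⟩
    · rw [Finset.prod_eq_single i (fun j _ hj => by simp [Pi.single_eq_of_ne hj]) (by simp),
        Pi.single_eq_same, pow_one]
      exact (charpoly_blockImage_congr h₁ h₂ h B).symm
    · rw [Finset.sum_eq_single i (fun j _ hj => by simp [Pi.single_eq_of_ne hj]) (by simp),
        Pi.single_eq_same, Nat.cast_one, one_mul]
      exact (trace_eq_of_mul_eq_mul h₁ h₂ (h g)).symm
  · obtain ⟨p, hp, hp'⟩ : ∃ p : Subrepresentation (unitaryRepresentation σ), p ≠ ⊥ ∧ p ≠ ⊤ := by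
      by_contra! hcon
      have : Nontrivial (Subrepresentation (unitaryRepresentation σ)) := by
        refine ⟨⊥, ⊤, fun e => ?_⟩
        have e' := congrArg Subrepresentation.toSubmodule e
        have : Nonempty (Fin d) := ⟨⟨0, hd⟩⟩
        exact bot_ne_top (α := Submodule ℂ (Fin d → ℂ)) e'
      exact hirr ⟨fun p => or_iff_not_imp_left.2 (hcon p)⟩
    obtain ⟨d₁, d₂, hd₁, hd₂, σ₁, σ₂, Q, Q', h₁, h₂, h⟩ := exists_blockDiagonal_of_invariant σ
      (p.toSubmodule.comap (WithLp.linearEquiv 2 ℂ (Fin d → ℂ)).toLinearMap)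
      (fun e => hp (Subrepresentation.toSubmodule_injective (by
        refine (Submodule.eq_bot_iff _).2 fun x hx => ?_
        have : WithLp.toLp 2 x ∈ (⊥ : Submodule ℂ (EuclideanSpace ℂ (Fin d))) := by
          rw [← e]; exact hx
        simpa using this)))
      (fun e => hp' (Subrepresentation.toSubmodule_injective (by
        refine (Submodule.eq_top_iff').2 fun x => ?_
        have : WithLp.toLp 2 x ∈ (⊤ : Submodule ℂ (EuclideanSpace ℂ (Fin d))) := trivial
        rw [← e] at this; exact this)))
      (fun g x hx => p.apply_mem_toSubmodule g hx)
    obtain ⟨n₁, hn₁, hn₁'⟩ := ih d₁ hd₁ σ₁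
    obtain ⟨n₂, hn₂, hn₂'⟩ := ih d₂ hd₂ σ₂
    let τ : G →* Matrix (Fin d₁ ⊕ Fin d₂) (Fin d₁ ⊕ Fin d₂) ℂ :=
      { toFun := fun g => fromBlocks (unitaryMatrixHom σ₁ g) 0 0 (unitaryMatrixHom σ₂ g)
        map_one' := by simp
        map_mul' := fun a b => by simp [fromBlocks_multiply] }
    have hτ : ∀ g, unitaryMatrixHom σ g * Q = Q * τ g := h
    refine ⟨n₁ + n₂, fun B => ?_, fun g => ?_⟩
    · rw [charpoly_blockImage_congr h₁ h₂ hτ, charpoly_blockImage_fromBlocks (τ := τ) (fun g => rfl),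
        hn₁, hn₂, ← Finset.prod_mul_distrib]
      simp only [Pi.add_apply, pow_add]
    · rw [trace_eq_of_mul_eq_mul h₁ h₂ (hτ g)]
      have htr : (τ g).trace = (unitaryMatrixHom σ₁ g).trace + (unitaryMatrixHom σ₂ g).trace := by
        simp [τ, Matrix.trace]
      rw [htr, hn₁', hn₂', ← Finset.sum_add_distrib]
      simp [add_mul]

end Decomposition

/-! ### Orthogonality of characters, and the rank of the sum over a subgroup -/

section Characters

variable {G : Type*} [Group G]

theorem character_unitaryRepresentation {d : ℕ} (σ : G →* Matrix.unitaryGroup (Fin d) ℂ) (g : G) :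
    (unitaryRepresentation σ).character g = (unitaryMatrixHom σ g).trace :=
  Matrix.trace_toLin'_eq _

variable [Fintype G]

variable {ι : Type*} {ρ : ι → UnitaryIrrep G}

open scoped Classical in
/-- Orthogonality of the irreducible characters in a complete system. -/
theorem sum_trace_mul_trace_inv (hρ : UnitaryIrrep.IsCompleteSystem ρ) (i j : ι) :
    (Nat.card G : ℂ)⁻¹ * ∑ g, (unitaryMatrixHom (ρ i).hom g).trace *
      (unitaryMatrixHom (ρ j).hom g⁻¹).trace = if i = j then 1 else 0 := by
  have hi := (ρ i).irreducible
  have hj := (ρ j).irreducible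
  let _ : Invertible (Nat.card G : ℂ) :=
    invertibleOfNonzero (by exact_mod_cast Nat.card_pos.ne')
  have := Representation.char_orthonormal (unitaryRepresentation (ρ i).hom)
    (unitaryRepresentation (ρ j).hom)
  simp only [character_unitaryRepresentation] at this
  rw [this]
  refine if_congr ⟨fun h => ?_, fun h => ?_⟩ rfl rfl
  · exact (hρ (ρ j)).unique h ⟨Representation.Equiv.refl _⟩
  · subst h; exact ⟨Representation.Equiv.refl _⟩

/-- There are finitely many irreducible representations, since their characters are linearly
independent in the finite-dimensional space of functions on `G`. -/
theorem UnitaryIrrep.IsCompleteSystem.finite (hρ : UnitaryIrrep.IsCompleteSystem ρ) :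
    Finite ι := by
  classical
  have hli : LinearIndependent ℂ fun i g => (unitaryMatrixHom (ρ i).hom g).trace := by
    refine linearIndependent_iff'.2 fun s c hc j hj => ?_
    have h0 : ∑ i ∈ s, c i * ((Nat.card G : ℂ)⁻¹ * ∑ g, (unitaryMatrixHom (ρ i).hom g).trace *
        (unitaryMatrixHom (ρ j).hom g⁻¹).trace) = 0 := by
      have hc' : ∀ g, ∑ i ∈ s, c i * (unitaryMatrixHom (ρ i).hom g).trace = 0 := fun g => by
        simpa using congrFun hc g
      calc _ = (Nat.card G : ℂ)⁻¹ * ∑ g, (∑ i ∈ s, c i * (unitaryMatrixHom (ρ i).hom g).trace) *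
            (unitaryMatrixHom (ρ j).hom g⁻¹).trace := by
            simp only [Finset.mul_sum, Finset.sum_mul]
            rw [Finset.sum_comm]
            refine Finset.sum_congr rfl fun g _ => Finset.sum_congr rfl fun i _ => by ring
        _ = 0 := by simp [hc']
    simp only [sum_trace_mul_trace_inv hρ] at h0
    simpa [hj] using h0
  exact hli.finite

/-- The multiplicities in a combination of irreducible characters are recovered as inner products. -/
theorem multiplicity_eq [Fintype ι] (hρ : UnitaryIrrep.IsCompleteSystem ρ) {f : G → ℂ} {n : ι → ℕ}
    (hf : ∀ g, f g = ∑ i, n i * (unitaryMatrixHom (ρ i).hom g).trace) (j : ι) :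
    (n j : ℂ) = (Nat.card G : ℂ)⁻¹ * ∑ g, f g * (unitaryMatrixHom (ρ j).hom g⁻¹).trace := by
  classical
  have : (Nat.card G : ℂ)⁻¹ * ∑ g, f g * (unitaryMatrixHom (ρ j).hom g⁻¹).trace =
      ∑ i, n i * ((Nat.card G : ℂ)⁻¹ * ∑ g, (unitaryMatrixHom (ρ i).hom g).trace *
        (unitaryMatrixHom (ρ j).hom g⁻¹).trace) := by
    simp only [hf, Finset.mul_sum, Finset.sum_mul]
    rw [Finset.sum_comm]
    refine Finset.sum_congr rfl fun g _ => Finset.sum_congr rfl fun i _ => by ring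
  rw [this]
  simp only [sum_trace_mul_trace_inv hρ]
  simp

open scoped Classical in
/-- The rank of `ρ(H)` is the mean of the character over `H`: `|H|⁻¹ ρ(H)` is idempotent, so its rank
is its trace. -/
theorem rank_subgroupSum (σ : UnitaryIrrep G) (H : Subgroup G) :
    ((σ.toAlgHom (subgroupSum H)).rank : ℂ) =
      (Nat.card H : ℂ)⁻¹ * ∑ g with g ∈ H, (unitaryMatrixHom σ.hom g).trace := by
  have hH : (Nat.card H : ℂ) ≠ 0 := by exact_mod_cast Nat.card_pos.ne'
  set M := σ.toAlgHom (subgroupSum H) with hM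
  have hMs : M = ∑ g with g ∈ H, unitaryMatrixHom σ.hom g := by
    simp [hM, subgroupSum, UnitaryIrrep.toAlgHom]
  have hmul : ∀ h ∈ H, unitaryMatrixHom σ.hom h * M = M := by
    intro h hh
    rw [hMs, Finset.mul_sum]
    refine Finset.sum_bij (fun g _ => h * g) (fun g hg => ?_) (fun _ _ _ _ e => mul_left_cancel e)
      (fun g hg => ⟨h⁻¹ * g, ?_, by simp⟩) (fun g _ => (map_mul _ _ _).symm)
    · simpa using H.mul_mem hh (by simpa using hg)
    · simpa using H.mul_mem (H.inv_mem hh) (by simpa using hg)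
  have hcard : ((Finset.univ.filter fun g => g ∈ H).card : ℂ) = Nat.card H := by
    rw [Nat.card_eq_fintype_card, Fintype.card_subtype]
  have hMM : M * M = (Nat.card H : ℂ) • M := by
    conv_lhs => rw [hMs, Finset.sum_mul]
    rw [← hMs, Finset.sum_congr rfl fun g hg => hmul g (by simpa using hg), Finset.sum_const,
      ← hcard, Nat.cast_smul_eq_nsmul]
  set E := (Nat.card H : ℂ)⁻¹ • M with hE
  have hEE : E * E = E := by
    rw [hE, smul_mul_smul_comm, hMM, smul_smul]
    congr 1; field_simp
  have hproj : LinearMap.IsProj (LinearMap.range (Matrix.toLin' E)) (Matrix.toLin' E) := by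
    refine ⟨fun x => LinearMap.mem_range_self _ x, ?_⟩
    rintro _ ⟨x, rfl⟩
    rw [← LinearMap.comp_apply, ← Matrix.toLin'_mul, hEE]
  have htr := hproj.trace
  have hrank : M.rank = E.rank := by
    have : M = (Nat.card H : ℂ) • E := by rw [hE, smul_smul, mul_inv_cancel₀ hH, one_smul]
    refine le_antisymm ?_ ?_
    · have e : M = E * ((Nat.card H : ℂ) • (1 : Matrix _ _ ℂ)) := by
        rw [this]; simp
      rw [e]; exact Matrix.rank_mul_le_left _ _
    · have e : E = M * ((Nat.card H : ℂ)⁻¹ • (1 : Matrix _ _ ℂ)) := by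
        rw [hE]; simp
      rw [e]; exact Matrix.rank_mul_le_left _ _
  rw [hrank, Matrix.rank, ← Matrix.toLin'_apply', ← htr, Matrix.trace_toLin'_eq, hE,
    Matrix.trace_smul, hMs, Matrix.trace_sum, smul_eq_mul]

end Characters

/-! ### The permutation representation on right cosets -/

section Cosets

open RightCosets

variable {G : Type*} [Group G] {H : Subgroup G}

theorem RightCosets.mk_eq_mk {x y : G} : RightCosets.mk H x = RightCosets.mk H y ↔ y * x⁻¹ ∈ H := by
  rw [← QuotientGroup.rightRel_apply]
  exact Quotient.eq

theorem RightCosets.exists_mk (J : RightCosets H) : ∃ x, RightCosets.mk H x = J :=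
  Quotient.exists_rep J

theorem RightCosets.card_eq_index [Fintype G] : Fintype.card (RightCosets H) = H.index := by
  rw [← Nat.card_eq_fintype_card, Subgroup.index]
  exact Nat.card_congr (QuotientGroup.quotientRightRelEquivQuotientLeftRel H)

theorem RightCosets.mulPerm_pow (g : G) (k : ℕ) : RightCosets.mulPerm H g ^ k =
    RightCosets.mulPerm H (g ^ k) := by
  induction k with
  | zero => ext J; simp [mulPerm, RightCosets.mul_one]
  | succ k ih =>
    rw [pow_succ', ih]
    ext J
    simp [mulPerm, RightCosets.mul_mul, pow_succ]

/-- The permutation representation of `G` on the right cosets of `H` by unitary matrices, with the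
cosets numbered by `e`. The `(J, K)` entry of the matrix of `g` is `1` when `J g = K`; with this
convention right multiplication gives a homomorphism, not an antihomomorphism. -/
noncomputable def cosetMatrixHom [Fintype G] {n : ℕ} (e : RightCosets H ≃ Fin n) :
    G →* Matrix.unitaryGroup (Fin n) ℂ where
  toFun g := ⟨Matrix.of fun i j => if (e.symm i).mul g = e.symm j then 1 else 0, by
    rw [Matrix.mem_unitaryGroup_iff]
    ext i j
    rw [Matrix.mul_apply, ← e.sum_comp]
    simp only [Matrix.of_apply, Matrix.star_apply, Equiv.symm_apply_apply, ite_mul, one_mul,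
      zero_mul, Finset.sum_ite_eq, Finset.mem_univ, if_true, Matrix.one_apply]
    have : (e.symm j).mul g = (e.symm i).mul g ↔ i = j := by
      rw [← e.symm.injective.eq_iff, eq_comm]
      exact (RightCosets.mulPerm H g).injective.eq_iff
    simp [this]⟩
  map_one' := by
    refine Subtype.ext ?_
    ext i j
    simp [RightCosets.mul_one, Matrix.one_apply]
  map_mul' a b := by
    refine Subtype.ext ?_
    ext i j
    simp only [Submonoid.coe_mul]
    rw [Matrix.mul_apply, ← e.sum_comp]
    simp only [Matrix.of_apply, Equiv.symm_apply_apply, ite_mul, one_mul, zero_mul,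
      Finset.sum_ite_eq, Finset.mem_univ, if_true, RightCosets.mul_mul]

variable [Fintype G]

theorem unitaryMatrixHom_cosetMatrixHom {n : ℕ} (e : RightCosets H ≃ Fin n) (g : G) (i j : Fin n) :
    unitaryMatrixHom (cosetMatrixHom e) g i j = if (e.symm i).mul g = e.symm j then 1 else 0 :=
  rfl

open scoped Classical in
/-- The inner product of the permutation character on the cosets with a class function `χ` is the
mean of `χ` over `H` (Frobenius reciprocity). -/
theorem sum_trace_cosetMatrixHom_mul {n : ℕ} (e : RightCosets H ≃ Fin n) (χ : G → ℂ)
    (hχ : ∀ x g, χ (x * g * x⁻¹) = χ g) :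
    (Nat.card G : ℂ)⁻¹ * ∑ g, (unitaryMatrixHom (cosetMatrixHom e) g).trace * χ g⁻¹ =
      (Nat.card H : ℂ)⁻¹ * ∑ g with g ∈ H, χ g := by
  have hcard : n = H.index := by
    rw [← RightCosets.card_eq_index, Fintype.card_congr e, Fintype.card_fin]
  have hJ : ∀ i, ∑ g, (unitaryMatrixHom (cosetMatrixHom e) g i i) * χ g⁻¹ =
      ∑ g with g ∈ H, χ g := by
    intro i
    obtain ⟨x, hx⟩ := RightCosets.exists_mk (e.symm i)
    rw [Finset.sum_filter]
    -- The stabilizer of the coset `H x` is `x⁻¹ H x`.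
    refine Fintype.sum_bijective (fun g => x * g⁻¹ * x⁻¹) ?_ _ _ fun g => ?_
    · exact ((MulAut.conj x).bijective.comp (Equiv.inv G).bijective)
    · rw [unitaryMatrixHom_cosetMatrixHom, ← hx, RightCosets.mk_mul, hχ, ite_mul, one_mul, zero_mul]
      refine if_congr ?_ rfl rfl
      rw [RightCosets.mk_eq_mk, mul_inv_rev, ← mul_assoc]
  have : ∑ g, (unitaryMatrixHom (cosetMatrixHom e) g).trace * χ g⁻¹ =
      n * ∑ g with g ∈ H, χ g := by
    simp only [Matrix.trace, Matrix.diag_apply, Finset.sum_mul]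
    rw [Finset.sum_comm, Finset.sum_congr rfl fun i _ => hJ i]
    simp
  have hH : (Nat.card H : ℂ) ≠ 0 := by exact_mod_cast Nat.card_pos.ne'
  have hn : (n : ℂ) ≠ 0 := by
    rw [hcard]; exact_mod_cast H.index_ne_zero_of_finite
  rw [this, ← H.card_mul_index, ← hcard, Nat.cast_mul]
  field_simp

/-- For any cosets `J`, `K` exactly `|H|` elements `g` satisfy `J g = K`, so `|H|⁻¹ ∑ g` acts on the
cosets as the all-one matrix. -/
theorem lift_cosetMatrixHom_averageSum {n : ℕ} (e : RightCosets H ≃ Fin n) (i j : Fin n) :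
    MonoidAlgebra.lift ℂ _ G (unitaryMatrixHom (cosetMatrixHom e)) (averageSum H) i j = 1 := by
  classical
  have hH : (Nat.card H : ℂ) ≠ 0 := by exact_mod_cast Nat.card_pos.ne'
  obtain ⟨x, hx⟩ := RightCosets.exists_mk (e.symm i)
  obtain ⟨y, hy⟩ := RightCosets.exists_mk (e.symm j)
  have h : ∑ g, unitaryMatrixHom (cosetMatrixHom e) g i j = Nat.card H := by
    rw [Nat.card_eq_fintype_card, Fintype.card_subtype, Finset.card_filter, Nat.cast_sum]
    refine Fintype.sum_bijective (fun g => y * (x * g)⁻¹) ?_ _ _ fun g => ?_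
    · exact (Equiv.mulLeft y).bijective.comp
        ((Equiv.inv G).bijective.comp (Equiv.mulLeft x).bijective)
    · rw [unitaryMatrixHom_cosetMatrixHom, ← hx, ← hy, RightCosets.mk_mul, Nat.cast_ite, Nat.cast_one,
        Nat.cast_zero]
      exact if_congr RightCosets.mk_eq_mk rfl rfl
  simp only [averageSum, map_smul, map_sum, MonoidAlgebra.lift_of, Matrix.smul_apply,
    Matrix.sum_apply, smul_eq_mul, h]
  exact inv_mul_cancel₀ hH

/-- If `π` permutes the `n` cosets in a single cycle, each coset is carried to each other one by
exactly one of `π⁰, …, πⁿ⁻¹`, so their sum acts as the all-one matrix. -/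
theorem lift_cosetMatrixHom_powerSum {n : ℕ} (e : RightCosets H ≃ Fin n) {π : G}
    (hπ : (RightCosets.mulPerm H π).IsCycleOn Set.univ) (i j : Fin n) :
    MonoidAlgebra.lift ℂ _ G (unitaryMatrixHom (cosetMatrixHom e)) (powerSum π n) i j = 1 := by
  classical
  have hcard : (Finset.univ : Finset (RightCosets H)).card = n := by
    rw [Finset.card_univ, Fintype.card_congr e, Fintype.card_fin]
  have hc : (RightCosets.mulPerm H π).IsCycleOn (Finset.univ : Finset (RightCosets H)) := by
    simpa using hπ
  obtain ⟨k, hk, hkj⟩ := hc.exists_pow_eq (Finset.mem_univ (e.symm i)) (Finset.mem_univ (e.symm j))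
  rw [hcard] at hk
  simp only [powerSum, map_sum, MonoidAlgebra.lift_of, Matrix.sum_apply,
    unitaryMatrixHom_cosetMatrixHom]
  have hpow : ∀ l, (e.symm i).mul (π ^ l) = (RightCosets.mulPerm H π ^ l) (e.symm i) := fun l => by
    rw [RightCosets.mulPerm_pow]; rfl
  rw [Finset.sum_eq_single_of_mem k (Finset.mem_range.2 hk), if_pos (by rw [hpow, hkj])]
  intro l hl hlk
  rw [if_neg]
  rw [hpow, ← hkj, hc.pow_apply_eq_pow_apply (Finset.mem_univ _), hcard]
  intro hmod
  exact hlk (hmod.eq_of_lt_of_lt (Finset.mem_range.1 hl) hk)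

end Cosets

/-! ### The universal matrix of the relative lift -/

section Lift

variable {V X : Type*} [Fintype X] {Γ : ArcGraph V X}
  {G : Type*} [Group G] [Fintype G] (α : VoltageAssignment Γ G) {H : Subgroup G}

theorem degree_relativeLift (u : V) (J : RightCosets H) :
    (Γ.relativeLift α H).degree (u, J) = Γ.degree u := by
  classical
  rw [ArcGraph.degree, ArcGraph.degree]
  refine Finset.card_nbij' Prod.fst (fun a => (a, J)) ?_ ?_ ?_ ?_ <;>
    simp [ArcGraph.relativeLift, Set.MapsTo, Set.LeftInvOn]

theorem adjMatrix_relativeLift {n : ℕ} (e : RightCosets H ≃ Fin n) (u v : V)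
    (J K : RightCosets H) :
    ((Γ.relativeLift α H).adjMatrix (u, J) (v, K) : ℂ) =
      MonoidAlgebra.lift ℂ _ G (unitaryMatrixHom (cosetMatrixHom e)) (baseAdj Γ α u v)
        (e J) (e K) := by
  classical
  simp only [ArcGraph.adjMatrix, baseAdj, Matrix.of_apply, map_sum, MonoidAlgebra.lift_of,
    Matrix.sum_apply, unitaryMatrixHom_cosetMatrixHom, Equiv.symm_apply_apply,
    Complex.ofReal_natCast]
  rw [Finset.sum_boole, Nat.cast_inj]
  refine Finset.card_nbij' Prod.fst (fun a => (a, J)) ?_ ?_ ?_ ?_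
  · rintro ⟨a, L⟩ h
    simp only [ArcGraph.relativeLift, Finset.coe_filter, Set.mem_ofPred_eq, Finset.mem_univ,
      true_and, Finset.mem_filter, Prod.mk.injEq] at h ⊢
    obtain ⟨⟨h₁, rfl⟩, h₂, h₃⟩ := h
    exact ⟨⟨h₁, h₂⟩, h₃⟩
  · intro a h
    simp only [ArcGraph.relativeLift, Finset.coe_filter, Set.mem_ofPred_eq, Finset.mem_univ,
      true_and, Finset.mem_filter, Prod.mk.injEq] at h ⊢
    exact ⟨⟨h.1.1, trivial⟩, h.1.2, h.2⟩
  · rintro ⟨a, L⟩ h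
    simp only [ArcGraph.relativeLift, Finset.coe_filter, Set.mem_ofPred_eq, Finset.mem_univ,
      true_and, Prod.mk.injEq] at h ⊢
    exact h.1.2.symm
  · intro a _
    rfl

variable [DecidableEq V]

/-- The universal matrix of the relative lift is the image of the universal base matrix under the
permutation representation on cosets, for every `s` that acts there as the all-one matrix. -/
theorem universalMatrix_relativeLift {n : ℕ} (e : RightCosets H ≃ Fin n) (c₁ c₂ c₃ c₄ : ℝ)
    {s : MonoidAlgebra ℂ G} (hs : ∀ i j,
      MonoidAlgebra.lift ℂ _ G (unitaryMatrixHom (cosetMatrixHom e)) s i j = 1) :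
    Matrix.reindex ((Equiv.refl V).prodCongr e) ((Equiv.refl V).prodCongr e)
      (((Γ.relativeLift α H).universalMatrix c₁ c₂ c₃ c₄).map ((↑) : ℝ → ℂ)) =
    blockImage (unitaryMatrixHom (cosetMatrixHom e)) (universalBaseMatrix Γ α s c₁ c₂ c₃ c₄) := by
  ext ⟨u, i⟩ ⟨v, j⟩
  obtain ⟨J, rfl⟩ := e.surjective i
  obtain ⟨K, rfl⟩ := e.surjective j
  have hD : ((Matrix.diagonal (fun p => ((Γ.relativeLift α H).degree p : ℝ))
      (u, J) (v, K) : ℝ) : ℂ) = MonoidAlgebra.lift ℂ _ G (unitaryMatrixHom (cosetMatrixHom e))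
        (Matrix.diagonal (fun u => (Γ.degree u : ℂ) • (1 : MonoidAlgebra ℂ G)) u v) (e J) (e K) := by
    rw [Matrix.diagonal_apply, Matrix.diagonal_apply, degree_relativeLift]
    by_cases huv : u = v <;> by_cases hJK : J = K <;> simp [huv, hJK]
  have hI : (((1 : Matrix (V × RightCosets H) (V × RightCosets H) ℝ) (u, J) (v, K) : ℝ) : ℂ) =
      MonoidAlgebra.lift ℂ _ G (unitaryMatrixHom (cosetMatrixHom e))
        ((1 : Matrix V V (MonoidAlgebra ℂ G)) u v) (e J) (e K) := by
    by_cases huv : u = v <;> by_cases hJK : J = K <;> simp [huv, hJK, Matrix.one_apply]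
  have hA := adjMatrix_relativeLift α e u v J K
  simp only [blockImage, universalBaseMatrix, ArcGraph.universalMatrix, Matrix.reindex_apply,
    Matrix.submatrix_apply, Matrix.map_apply, Matrix.of_apply, Matrix.add_apply, Matrix.smul_apply,
    map_add, map_smul, hs, smul_eq_mul, Complex.ofReal_add, Complex.ofReal_mul, ← hD, ← hI, ← hA,
    Equiv.prodCongr_symm, Equiv.prodCongr_apply, Prod.map, Equiv.symm_apply_apply,
    Equiv.refl_symm, Equiv.refl_apply, Complex.ofReal_one]

variable [Fintype V]

/-- The spectrum of the lift, for every `s` that acts on the cosets as the all-one matrix. -/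
theorem matrixSpectrum_relativeLift {n : ℕ} (e : RightCosets H ≃ Fin n) (c₁ c₂ c₃ c₄ : ℝ)
    {s : MonoidAlgebra ℂ G} (hs : ∀ i j,
      MonoidAlgebra.lift ℂ _ G (unitaryMatrixHom (cosetMatrixHom e)) s i j = 1)
    {ι : Type*} [Fintype ι] {ρ : ι → UnitaryIrrep G} (hρ : UnitaryIrrep.IsCompleteSystem ρ) :
    matrixSpectrum (((Γ.relativeLift α H).universalMatrix c₁ c₂ c₃ c₄).map ((↑) : ℝ → ℂ)) =
      ∑ i, ((ρ i).toAlgHom (subgroupSum H)).rank •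
        matrixSpectrum ((ρ i).image (universalBaseMatrix Γ α s c₁ c₂ c₃ c₄)) := by
  obtain ⟨m, hm, htr⟩ := exists_multiplicities hρ (V := V) (cosetMatrixHom e)
  have hmr : ∀ i, m i = ((ρ i).toAlgHom (subgroupSum H)).rank := by
    intro i
    have h := multiplicity_eq hρ htr i
    rw [sum_trace_cosetMatrixHom_mul e (fun g => (unitaryMatrixHom (ρ i).hom g).trace)
      (fun x g => ?_), ← rank_subgroupSum] at h
    · exact_mod_cast h
    · rw [map_mul, Matrix.trace_mul_comm, ← map_mul, inv_mul_cancel_left]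
  rw [matrixSpectrum, ← Matrix.charpoly_reindex ((Equiv.refl V).prodCongr e),
    universalMatrix_relativeLift α e c₁ c₂ c₃ c₄ hs, hm, Polynomial.roots_prod]
  · simp only [Polynomial.roots_pow, ← hmr, matrixSpectrum]
    rfl
  · exact Finset.prod_ne_zero_iff.2 fun i _ => pow_ne_zero _ (Matrix.charpoly_monic _).ne_zero

end Lift

theorem theorem1 {V X : Type*} [Fintype V] [DecidableEq V] [Fintype X] (Γ : ArcGraph V X)
    {G : Type*} [Group G] [Fintype G] (α : VoltageAssignment Γ G)
    (H : Subgroup G) (n : ℕ) (hn : H.index = n) (c₁ c₂ c₃ c₄ : ℝ)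
    {ι : Type*} (ρ : ι → UnitaryIrrep G) (hρ : UnitaryIrrep.IsCompleteSystem ρ) :
    Multiset.card (matrixSpectrum
        (((Γ.relativeLift α H).universalMatrix c₁ c₂ c₃ c₄).map ((↑) : ℝ → ℂ))) =
      Fintype.card V * n ∧
    ∃ _ : Fintype ι,
      (∀ π : G, (RightCosets.mulPerm H π).IsCycleOn Set.univ →
        matrixSpectrum
            (((Γ.relativeLift α H).universalMatrix c₁ c₂ c₃ c₄).map ((↑) : ℝ → ℂ)) =
          ∑ i, ((ρ i).toAlgHom (subgroupSum H)).rank •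
            matrixSpectrum
              ((ρ i).image (universalBaseMatrix Γ α (powerSum π n) c₁ c₂ c₃ c₄))) ∧
      matrixSpectrum
          (((Γ.relativeLift α H).universalMatrix c₁ c₂ c₃ c₄).map ((↑) : ℝ → ℂ)) =
        ∑ i, ((ρ i).toAlgHom (subgroupSum H)).rank •
          matrixSpectrum
            ((ρ i).image (universalBaseMatrix Γ α (averageSum H) c₁ c₂ c₃ c₄)) := by
  have hcard : Fintype.card (RightCosets H) = n := RightCosets.card_eq_index.trans hn
  let e : RightCosets H ≃ Fin n := Fintype.equivFinOfCardEq hcard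
  have := hρ.finite
  let _ : Fintype ι := Fintype.ofFinite ι
  refine ⟨?_, inferInstance, fun π hπ => ?_, ?_⟩
  · rw [matrixSpectrum, ← (IsAlgClosed.splits _).natDegree_eq_card_roots,
      Matrix.charpoly_natDegree_eq_dim, Fintype.card_prod, hcard]
  · exact matrixSpectrum_relativeLift α e c₁ c₂ c₃ c₄ (lift_cosetMatrixHom_powerSum e hπ) hρ
  · exact matrixSpectrum_relativeLift α e c₁ c₂ c₃ c₄ (lift_cosetMatrixHom_averageSum e) hρ
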